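/- Let $Y$ be a smooth $3$-manifold, possibly with boundary, let $\pi:Y\to S^1=\mathbb R/2\pi\mathbb Z$ be a smooth fibration, and let $\Pi$ be the set of all smooth fibrations $\pi':Y\to S^1$ isotopic to $\pi$ (joined to $\pi$ by a smooth family of smooth fibrations). For a vector field $X$ on $Y$ with (unique, global) flow $\phi^t$ and a finite $\phi^t$-invariant Borel measure $\mu$ on $Y$, the flux of $X$ through $S\subset Y$ and the wrappingness are $$\mathrm{Flux}(X,\mu,S)=\lim_{\epsilon\to0^+}\frac1\epsilon\,\mu\Big(\bigcup_{0\le s\le\epsilon}\phi^{s}(S)\Big),\qquad Wrp(X,\mu,\pi)=\inf_{\pi'\in\Pi}\ \inf_{\theta\in S^1}\mathrm{Flux}\big(X,\mu,\pi'^{-1}(\theta)\big).$$ Let $C=T^2\times[0,1]=S^1\times(S^1\times[0,1])$, with coordinates $x_1,x_2\in\mathbb R/2\pi\mathbb Z$ and $t\in[0,1]$, be smoothly embedded in $Y$ so that $\pi$ restricts on $C$ to the projection $(x_1,x_2,t)\mapsto x_1$, i.e. to the fibration defined by the closed $1$-form $dx_1$. Let $f,g:[0,1]\to\mathbb R$ be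 continuous and suppose that on $C$ the vector field $X$ is $T^2$-invariant of the form $$X=f(t)\,\partial_{x_1}+g(t)\,\partial_{x_2}.$$ Let $\Omega_C$ be the ($X$-invariant) measure on $Y$ concentrated on $C$ and given there by the volume form $dt\wedge dx_1\wedge dx_2$. Then the limit defining the flux through $\pi'^{-1}(\theta)$ exists for all $\pi'\in\Pi$ and $\theta\in S^1$, and $$Wrp(X,\Omega_C,\pi)=2\pi\int_0^1|f(t)|\,dt .$$ (The case $Y=C$, $\pi=x_1$ is included.) -/

import Mathlib

open Set Filter Topology MeasureTheory
open scoped Manifold ContDiff ENNReal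

noncomputable section

universe uE uH u

/-! ### Smooth fibrations over the circle and their isotopies -/

/-- `π : Y → S¹` is a smooth fibration: a smooth map which is smoothly locally trivial, i.e. over a
neighbourhood `U` of each point of `S¹` there is a smooth manifold `F` (possibly with boundary) and
a diffeomorphism `π ⁻¹(U) ≅ U × F` which commutes with the projections to `U`. -/
def IsSmoothFibration {E : Type uE} [NormedAddCommGroup E] [NormedSpace ℝ E]
    {H : Type uH} [TopologicalSpace H] (I : ModelWithCorners ℝ E H)
    {Y : Type u} [TopologicalSpace Y] [ChartedSpace H Y] (π : Y → Circle) : Prop :=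
  ContMDiff I (𝓡 1) ∞ π ∧
  ∀ θ : Circle, ∃ U : Set Circle, IsOpen U ∧ θ ∈ U ∧
    ∃ (E' : Type) (_ : NormedAddCommGroup E') (_ : NormedSpace ℝ E')
      (H' : Type) (_ : TopologicalSpace H') (J : ModelWithCorners ℝ E' H')
      (F : Type u) (_ : TopologicalSpace F) (_ : ChartedSpace H' F) (_ : IsManifold J ∞ F)
      (Φ : PartialDiffeomorph I ((𝓡 1).prod J) Y (Circle × F) ∞),
      Φ.source = π ⁻¹' U ∧ Φ.target = U ×ˢ (univ : Set F) ∧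
      ∀ y ∈ π ⁻¹' U, (Φ y).1 = π y

/-- The set `Π` of all smooth fibrations `π' : Y → S¹` isotopic to `π`, i.e. joined to `π` by a
smooth family `P s`, `s ∈ [0,1]`, of smooth fibrations. -/
def fibrationsIsotopicTo {E : Type uE} [NormedAddCommGroup E] [NormedSpace ℝ E]
    {H : Type uH} [TopologicalSpace H] (I : ModelWithCorners ℝ E H)
    {Y : Type u} [TopologicalSpace Y] [ChartedSpace H Y] (π : Y → Circle) : Set (Y → Circle) :=
  {π' | ∃ P : ℝ → Y → Circle,
    ContMDiffOn (𝓘(ℝ, ℝ).prod I) (𝓡 1) ∞ (fun q : ℝ × Y => P q.1 q.2) (Icc 0 1 ×ˢ univ) ∧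
    (∀ s ∈ Icc (0 : ℝ) 1, IsSmoothFibration I (P s)) ∧ P 0 = π ∧ P 1 = π'}

/-! ### Flows, flux and wrappingness -/

/-- `φ` is the (global) flow of the vector field `X`: for each `y`, the curve `s ↦ φ s y` is the
unique integral curve of `X` which starts at `y`. -/
structure IsFlowOf {E : Type uE} [NormedAddCommGroup E] [NormedSpace ℝ E]
    {H : Type uH} [TopologicalSpace H] (I : ModelWithCorners ℝ E H)
    {Y : Type u} [TopologicalSpace Y] [ChartedSpace H Y]
    (X : (y : Y) → TangentSpace I y) (φ : ℝ → Y → Y) : Prop where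
  zero : ∀ y, φ 0 y = y
  integral : ∀ y, IsMIntegralCurve (I := I) (fun s => φ s y) X
  unique : ∀ γ : ℝ → Y, IsMIntegralCurve (I := I) γ X → ∀ s, γ s = φ s (γ 0)

/-- The set `φ^{[0,ε]}(S)` swept out by `S` under the flow during the time interval `[0,ε]`. -/
def sweep {Y : Type u} (φ : ℝ → Y → Y) (ε : ℝ) (S : Set Y) : Set Y :=
  ⋃ s ∈ Icc (0 : ℝ) ε, φ s '' S

/-- The quotient `μ(φ^{[0,ε]}(S)) / ε`. -/
def fluxQuotient {Y : Type u} [MeasurableSpace Y] (φ : ℝ → Y → Y) (μ : Measure Y) (S : Set Y)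
    (ε : ℝ) : ℝ≥0∞ :=
  μ (sweep φ ε S) / ENNReal.ofReal ε

/-- The geometric flux `lim_{ε → 0} (1/ε) μ(φ^{[0,ε]}(S))`. It is written as a lower limit, which
is the limit whenever the limit exists. -/
def flux {Y : Type u} [MeasurableSpace Y] (φ : ℝ → Y → Y) (μ : Measure Y) (S : Set Y) : ℝ≥0∞ :=
  liminf (fluxQuotient φ μ S) (𝓝[>] (0 : ℝ))

/-- The wrappingness of the measure `μ`, invariant under the flow `φ`, with respect to the
fibration `π`: the infimum of the flux through a fibre `π' ⁻¹(θ)`, over all smooth fibrations `π'`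
isotopic to `π` and all `θ ∈ S¹`. -/
def wrappingness {E : Type uE} [NormedAddCommGroup E] [NormedSpace ℝ E]
    {H : Type uH} [TopologicalSpace H] (I : ModelWithCorners ℝ E H)
    {Y : Type u} [TopologicalSpace Y] [ChartedSpace H Y] [MeasurableSpace Y]
    (φ : ℝ → Y → Y) (μ : Measure Y) (π : Y → Circle) : ℝ≥0∞ :=
  ⨅ π' ∈ fibrationsIsotopicTo I π, ⨅ θ : Circle, flux φ μ (π' ⁻¹' {θ})

/-! ### The thickened torus -/

/-- The thickened torus `T² × [0,1] = S¹ × (S¹ × [0,1])`. -/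
abbrev ThickTorus : Type := Circle × (Circle × Icc (0 : ℝ) 1)

/-- The model of the thickened torus, as a smooth manifold with boundary. -/
abbrev thickTorusModel :=
  (𝓡 1).prod ((𝓡 1).prod (𝓡∂ 1))

/-- The point of the thickened torus with angular coordinates `x₁, x₂` (of period `2π`) and
height `t`. -/
def torusPoint (x₁ x₂ : ℝ) (t : Icc (0 : ℝ) 1) : ThickTorus :=
  (Circle.exp x₁, (Circle.exp x₂, t))

/-- The measure on `Y` given by the volume form `dt ∧ dx₁ ∧ dx₂` on a thickened torus embedded in
`Y` by `e`, with `x₁, x₂ ∈ [0,2π]` and `t ∈ [0,1]`; it is concentrated on the image of `e`. -/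
def thickTorusVolume {Y : Type u} [MeasurableSpace Y] (e : ThickTorus → Y) : Measure Y :=
  Measure.map
    (fun x : ℝ × ℝ × ℝ => e (torusPoint x.1 x.2.1 (projIcc 0 1 zero_le_one x.2.2)))
    (volume.restrict (Ico 0 (2 * Real.pi) ×ˢ Ico 0 (2 * Real.pi) ×ˢ Icc 0 1))

end

noncomputable section

/-! ### The limit defining the flux exists -/

/-! The flow preserves every torus `t = const` in `C` and rotates it rigidly, so it preserves the
volume. Swept volume is then subadditive in time, and its quotient by `ε` converges to its supremum,
for any set whatever.

Upper bound: the fibre `x₁ = θ` of `π` itself sweeps, on each circle with `x₂` and `t` fixed, an arc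
of length at most `ε |f(t)|` (`torusMeasure_sweep_fst_le`).

Lower bound: by homotopy lifting, an isotopic fibration restricts to `C` as `exp(h) x₁` with `h`
real and continuous. Count crossings of the fibre along a flow line during time `ε` by the change
`D` of the integer part of a lift divided by `2π`. For small `ε`, `|D| ≤ 1`, and `D ≠ 0` only if the
endpoint lies in the swept set, so the integral of `σ D` with `|σ| ≤ 1` bounds the swept volume from
below. Moreover `D` is `ε f / 2π` plus a coboundary `K ∘ φ^ε - K`. Taking for `σ` the flow-invariant
sign of `f(t)`, the coboundary integrates to zero and `2π ε ∫ |f|` remains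
(`eventually_le_torusMeasure_sweep`). Only continuity of `h` enters: no transversality or regularity
of the fibre. -/

/-- A monotone subadditive function `m` of `ε > 0` has a limit `m ε / ε` as `ε → 0`, namely the
supremum of these quotients. -/
theorem tendsto_div_of_subadditive {m : ℝ → ℝ≥0∞} (hmono : Monotone m)
    (hsub : ∀ a b, 0 ≤ a → 0 ≤ b → m (a + b) ≤ m a + m b) :
    Tendsto (fun ε => m ε / ENNReal.ofReal ε) (𝓝[>] (0 : ℝ))
      (𝓝 (⨆ ε : Ioi (0 : ℝ), m ε / ENNReal.ofReal ε)) := by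
  have hmul : ∀ (n : ℕ) (ε : ℝ), 0 < ε → m ((n + 1 : ℕ) * ε) ≤ (n + 1 : ℕ) * m ε := by
    intro n ε hε
    induction n with
    | zero => simp
    | succ n ih =>
      have h1 : ((n + 1 + 1 : ℕ) : ℝ) * ε = (n + 1 : ℕ) * ε + ε := by push_cast; ring
      have h2 : ((n + 1 + 1 : ℕ) : ℝ≥0∞) * m ε = (n + 1 : ℕ) * m ε + m ε := by
        push_cast; ring
      rw [h1, h2]
      exact (hsub _ _ (by positivity) hε.le).trans (by gcongr)
  refine tendsto_order.2 ⟨fun c hc => ?_, fun c hc => ?_⟩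
  · obtain ⟨⟨T, hT⟩, hcT⟩ := lt_iSup_iff.1 hc
    have hT : 0 < T := hT
    -- `T ≤ k ε ≤ T + ε` gives `m T / (T + ε) ≤ m ε / ε`
    have key : ∀ ε, 0 < ε → m T / ENNReal.ofReal (T + ε) ≤ m ε / ENNReal.ofReal ε := by
      intro ε hε
      obtain ⟨n, hn⟩ : ∃ n : ℕ, ⌈T / ε⌉₊ = n + 1 :=
        Nat.exists_eq_succ_of_ne_zero (Nat.ceil_pos.2 (by positivity)).ne'
      have h1 : T ≤ (n + 1 : ℕ) * ε := by
        rw [← hn, ← div_le_iff₀ hε]; exact Nat.le_ceil _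
      have h2 : (n + 1 : ℕ) * ε ≤ T + ε := by
        rw [← hn]
        have := (Nat.ceil_lt_add_one (show 0 ≤ T / ε by positivity)).le
        calc (⌈T / ε⌉₊ : ℝ) * ε ≤ (T / ε + 1) * ε := by gcongr
          _ = T + ε := by field_simp
      have hε' : ENNReal.ofReal ε ≠ 0 := by simpa using hε
      have h3 : ((n + 1 : ℕ) : ℝ≥0∞) ≤ ENNReal.ofReal (T + ε) / ENNReal.ofReal ε := by
        rw [ENNReal.le_div_iff_mul_le (Or.inl hε') (Or.inl ENNReal.ofReal_ne_top),
          ← ENNReal.ofReal_natCast, ← ENNReal.ofReal_mul (by positivity)]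
        exact ENNReal.ofReal_le_ofReal h2
      refine ENNReal.div_le_of_le_mul ?_
      calc m T ≤ m ((n + 1 : ℕ) * ε) := hmono h1
        _ ≤ (n + 1 : ℕ) * m ε := hmul n ε hε
        _ ≤ ENNReal.ofReal (T + ε) / ENNReal.ofReal ε * m ε := by gcongr
        _ = m ε / ENNReal.ofReal ε * ENNReal.ofReal (T + ε) := by
          simp only [div_eq_mul_inv]; ring
    have hlim : Tendsto (fun ε => m T / ENNReal.ofReal (T + ε)) (𝓝[>] (0 : ℝ))
        (𝓝 (m T / ENNReal.ofReal T)) := by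
      refine ENNReal.Tendsto.const_div ?_ (Or.inl ENNReal.ofReal_ne_top)
      refine (ENNReal.tendsto_ofReal ?_).mono_left nhdsWithin_le_nhds
      have : Continuous fun ε : ℝ => T + ε := by fun_prop
      simpa using this.tendsto 0
    filter_upwards [hlim.eventually_const_lt hcT, self_mem_nhdsWithin] with ε h1 h2
    exact h1.trans_le (key ε h2)
  · filter_upwards [self_mem_nhdsWithin] with ε hε
    exact (le_iSup (fun ε : Ioi (0 : ℝ) => m ε / ENNReal.ofReal ε) ⟨ε, hε⟩).trans_lt hc

theorem sweep_mono {Y : Type*} (φ : ℝ → Y → Y) (S : Set Y) : Monotone fun ε => sweep φ ε S :=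
  fun _ _ h => biUnion_subset_biUnion_left (Icc_subset_Icc_right h)

theorem mem_sweep {Y : Type*} {φ : ℝ → Y → Y} {ε : ℝ} {S : Set Y} {y : Y} :
    y ∈ sweep φ ε S ↔ ∃ s ∈ Icc (0 : ℝ) ε, ∃ x ∈ S, φ s x = y := by
  simp [sweep]

/-- The flux quotient through any set converges if the flow preserves the measure. -/
theorem tendsto_fluxQuotient {Y : Type*} [MeasurableSpace Y] {φ : ℝ → Y → Y} {μ : Measure Y}
    (hadd : ∀ s r y, φ (s + r) y = φ s (φ r y))
    (hφ : ∀ s A, μ (φ s '' A) = μ A) (S : Set Y) :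
    Tendsto (fluxQuotient φ μ S) (𝓝[>] (0 : ℝ)) (𝓝 (flux φ μ S)) := by
  have h := tendsto_div_of_subadditive (m := fun ε => μ (sweep φ ε S))
    (fun _ _ h => measure_mono (sweep_mono φ S h)) (fun a b ha hb => by
      -- Times beyond `a` contribute the `φ a`-image of a shorter sweep. Only monotonicity and
      -- subadditivity of outer measure are needed, so `S` may be arbitrary.
      have hsub : sweep φ (a + b) S ⊆ sweep φ a S ∪ φ a '' sweep φ b S := by
        intro y hy
        obtain ⟨s, hs, x, hx, rfl⟩ := mem_sweep.1 hy
        rcases le_total s a with h | h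
        · exact Or.inl (mem_sweep.2 ⟨s, ⟨hs.1, h⟩, x, hx, rfl⟩)
        · refine Or.inr ⟨φ (s - a) x, mem_sweep.2 ⟨s - a, ⟨by linarith, by linarith [hs.2]⟩,
            x, hx, rfl⟩, ?_⟩
          rw [← hadd, add_sub_cancel]
      refine (measure_mono hsub).trans ((measure_union_le _ _).trans ?_)
      rw [hφ])
  have h' : Tendsto (fluxQuotient φ μ S) (𝓝[>] (0 : ℝ))
      (𝓝 (⨆ ε : Ioi (0 : ℝ), μ (sweep φ ε S) / ENNReal.ofReal ε)) := h
  have hl : flux φ μ S = _ := h'.liminf_eq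
  rwa [hl]

/-! ### The invariant measure on the thickened torus -/

instance : MeasurableSpace Circle := borel Circle

instance : BorelSpace Circle := ⟨rfl⟩

/-- The measure `dx` on the circle, of total mass `2π`. -/
def circleMeasure : Measure Circle :=
  Measure.map Circle.exp (volume.restrict (Ioc 0 (2 * Real.pi)))

/-- Every half-open interval of length `2π` is a fundamental domain. The freedom in `c` gives
rotation invariance and the arc estimate. -/
theorem measurePreserving_circleExp (c : ℝ) :
    MeasurePreserving Circle.exp (volume.restrict (Ioc c (c + 2 * Real.pi))) circleMeasure := by
  have : Fact (0 < 2 * Real.pi) := ⟨Real.two_pi_pos⟩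
  refine ⟨Circle.exp.continuous.measurable, ?_⟩
  have h : ∀ c : ℝ, Measure.map Circle.exp (volume.restrict (Ioc c (c + 2 * Real.pi))) =
      Measure.map (AddCircle.homeomorphCircle' : AddCircle (2 * Real.pi) → Circle) volume := by
    intro c
    rw [← (AddCircle.measurePreserving_mk (2 * Real.pi) c).map_eq, Measure.map_map
      AddCircle.homeomorphCircle'.continuous.measurable AddCircle.measurable_mk']
    rfl
  rw [h, circleMeasure, ← h 0, zero_add]

instance : IsFiniteMeasure circleMeasure := by
  unfold circleMeasure; infer_instance

theorem circleMeasure_univ : circleMeasure univ = ENNReal.ofReal (2 * Real.pi) := by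
  rw [circleMeasure, Measure.map_apply Circle.exp.continuous.measurable MeasurableSet.univ]
  simp

theorem measurePreserving_mul_right_circle (z : Circle) :
    MeasurePreserving (fun a => a * z) circleMeasure circleMeasure := by
  obtain ⟨c, rfl⟩ : ∃ c, Circle.exp c = z := ⟨_, Circle.exp_arg z⟩
  refine ⟨(continuous_mul_const _).measurable, ?_⟩
  have h : (fun a => a * Circle.exp c) ∘ Circle.exp = Circle.exp ∘ (fun x => x + c) := by
    ext x; simp [Circle.exp_add]
  have h2 : Measure.map (fun x => x + c) (volume.restrict (Ioc 0 (0 + 2 * Real.pi))) =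
      volume.restrict (Ioc c (c + 2 * Real.pi)) := by
    have := (measurePreserving_add_right (volume : Measure ℝ) c).restrict_preimage
      (s := Ioc c (c + 2 * Real.pi)) measurableSet_Ioc
    rw [← this.map_eq]
    simp [add_sub_cancel_left]
  conv_lhs => rw [← (measurePreserving_circleExp 0).map_eq]
  rw [Measure.map_map (continuous_mul_const _).measurable Circle.exp.continuous.measurable, h,
    ← Measure.map_map Circle.exp.continuous.measurable (measurable_add_const c), h2,
    (measurePreserving_circleExp c).map_eq]

/-- Only an inequality, since an arc longer than a full turn overlaps itself. -/
theorem circleMeasure_arc_le {c d : ℝ} :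
    circleMeasure (Circle.exp '' uIcc c d) ≤ ENNReal.ofReal |d - c| := by
  wlog hcd : c ≤ d generalizing c d
  · rw [uIcc_comm, abs_sub_comm]; exact this (le_of_not_ge hcd)
  rw [uIcc_of_le hcd, abs_of_nonneg (sub_nonneg.2 hcd)]
  rcases le_or_gt (2 * Real.pi) (d - c) with h | h
  · calc _ ≤ circleMeasure univ := measure_mono (subset_univ _)
      _ ≤ _ := by rw [circleMeasure_univ]; exact ENNReal.ofReal_le_ofReal h
  have hm : MeasurableSet (Circle.exp '' Icc c d) :=
    (isCompact_Icc.image Circle.exp.continuous).measurableSet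
  rw [← (measurePreserving_circleExp c).measure_preimage hm.nullMeasurableSet,
    Measure.restrict_apply (Circle.exp.continuous.measurable hm)]
  -- In the fundamental domain starting at `c`, the one extra point is `c + 2π`, the translate of
  -- the endpoint `c`; it is null.
  have hsub : Circle.exp ⁻¹' (Circle.exp '' Icc c d) ∩ Ioc c (c + 2 * Real.pi) ⊆
      Ioc c d ∪ {c + 2 * Real.pi} := by
    rintro x ⟨⟨y, hy, hxy⟩, hx⟩
    obtain ⟨n, hn⟩ := Circle.exp_eq_exp.1 hxy.symm
    have hpi := Real.pi_pos
    have h1 : n < 2 := by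
      have : (n : ℝ) < 2 := by
        by_contra hcon
        push Not at hcon
        nlinarith [hx.2, hy.1]
      exact_mod_cast this
    have h2 : -1 < n := by
      have : (-1 : ℝ) < n := by
        by_contra hcon
        push Not at hcon
        nlinarith [hx.1, hy.2]
      exact_mod_cast this
    obtain rfl | rfl : n = 0 ∨ n = 1 := by omega
    · left
      simp only [Int.cast_zero, zero_mul, add_zero] at hn
      exact ⟨hx.1, hn ▸ hy.2⟩
    · right
      simp only [Int.cast_one, one_mul] at hn
      exact le_antisymm hx.2 (by linarith [hy.1])
  refine (measure_mono hsub).trans ((measure_union_le _ _).trans ?_)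
  simp

/-- The measure `dx₁ dx₂ dt` on the thickened torus. -/
def torusMeasure : Measure ThickTorus := circleMeasure.prod (circleMeasure.prod volume)

instance : IsFiniteMeasure torusMeasure := by
  unfold torusMeasure; infer_instance

theorem map_projIcc_volume :
    Measure.map (projIcc (0 : ℝ) 1 zero_le_one) (volume.restrict (Icc 0 1)) = volume := by
  rw [← map_comap_subtype_coe measurableSet_Icc,
    Measure.map_map continuous_projIcc.measurable measurable_subtype_coe]
  have : projIcc (0 : ℝ) 1 zero_le_one ∘ ((↑) : Icc (0 : ℝ) 1 → ℝ) = id := by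
    ext t; simp
  rw [this, Measure.map_id, Measure.Subtype.volume_def]

theorem torusMeasure_eq_map : torusMeasure = Measure.map
    (fun x : ℝ × ℝ × ℝ => torusPoint x.1 x.2.1 (projIcc 0 1 zero_le_one x.2.2))
    (volume.restrict (Ico 0 (2 * Real.pi) ×ˢ Ico 0 (2 * Real.pi) ×ˢ Icc 0 1)) := by
  have hIco : circleMeasure = Measure.map Circle.exp (volume.restrict (Ico 0 (2 * Real.pi))) := by
    rw [circleMeasure, restrict_Ico_eq_restrict_Ioc]
  have he : Measurable Circle.exp := Circle.exp.continuous.measurable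
  have hp : Measurable (projIcc (0 : ℝ) 1 zero_le_one) := continuous_projIcc.measurable
  rw [torusMeasure, hIco, ← map_projIcc_volume, Measure.map_prod_map _ _ he hp,
    Measure.map_prod_map _ _ he (he.prodMap hp), Measure.prod_restrict, Measure.prod_restrict]
  rfl

theorem thickTorusVolume_eq_map {Y : Type*} [TopologicalSpace Y] [MeasurableSpace Y]
    [BorelSpace Y] {e : ThickTorus → Y} (he : Continuous e) :
    thickTorusVolume e = Measure.map e torusMeasure := by
  have hp : Measurable
      (fun x : ℝ × ℝ × ℝ => torusPoint x.1 x.2.1 (projIcc 0 1 zero_le_one x.2.2)) := by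
    have : Continuous (projIcc (0 : ℝ) 1 zero_le_one) := continuous_projIcc
    refine Continuous.measurable ?_
    unfold torusPoint
    fun_prop
  rw [torusMeasure_eq_map, Measure.map_map he.measurable hp]
  rfl

/-! ### The rotation flow on the thickened torus. -/

/-- The flow of `F(t) ∂₁ + G(t) ∂₂` on the thickened torus. -/
def torusFlow (F G : Icc (0 : ℝ) 1 → ℝ) (s : ℝ) (p : ThickTorus) : ThickTorus :=
  (p.1 * Circle.exp (s * F p.2.2), (p.2.1 * Circle.exp (s * G p.2.2), p.2.2))

section TorusFlow

variable {F G : Icc (0 : ℝ) 1 → ℝ}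

theorem torusFlow_add (s r : ℝ) (p : ThickTorus) :
    torusFlow F G (s + r) p = torusFlow F G s (torusFlow F G r p) := by
  simp only [torusFlow, add_mul, Circle.exp_add, Prod.mk.injEq, and_true]
  constructor
  · rw [mul_assoc, mul_comm (Circle.exp (s * _))]
  · rw [mul_assoc, mul_comm (Circle.exp (s * _))]

@[simp] theorem torusFlow_zero (p : ThickTorus) : torusFlow F G 0 p = p := by
  simp [torusFlow]

theorem torusFlow_neg_torusFlow (s : ℝ) (p : ThickTorus) :
    torusFlow F G (-s) (torusFlow F G s p) = p := by
  rw [← torusFlow_add, neg_add_cancel, torusFlow_zero]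

theorem torusFlow_torusFlow_neg (s : ℝ) (p : ThickTorus) :
    torusFlow F G s (torusFlow F G (-s) p) = p := by
  rw [← torusFlow_add, add_neg_cancel, torusFlow_zero]

theorem continuous_torusFlow (hF : Continuous F) (hG : Continuous G) :
    Continuous fun q : ℝ × ThickTorus => torusFlow F G q.1 q.2 := by
  unfold torusFlow
  fun_prop

/-- Fubini: each circle is rotated by an angle depending only on the base point. The torus flow is a
composition of such maps, as its angles depend on `t` alone. -/
theorem measurePreserving_rotate {Q : Type*} [MeasurableSpace Q] (μ : Measure Q) [SFinite μ]
    {κ : Q → Circle} (hκ : Measurable κ) :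
    MeasurePreserving (fun p : Circle × Q => (p.1 * κ p.2, p.2))
      (circleMeasure.prod μ) (circleMeasure.prod μ) := by
  have h := (MeasurePreserving.id μ).skew_product (μc := circleMeasure) (μd := circleMeasure)
    (g := fun q a => a * κ q) (measurable_snd.mul (hκ.comp measurable_fst))
    (ae_of_all _ fun q => (measurePreserving_mul_right_circle (κ q)).map_eq)
  exact Measure.measurePreserving_swap.comp (h.comp Measure.measurePreserving_swap)

theorem measurePreserving_torusFlow (hF : Continuous F) (hG : Continuous G) (s : ℝ) :
    MeasurePreserving (torusFlow F G s) torusMeasure torusMeasure := by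
  have h1 := measurePreserving_rotate (circleMeasure.prod (volume : Measure (Icc (0 : ℝ) 1)))
    (κ := fun q => Circle.exp (s * F q.2)) (Continuous.measurable (by fun_prop))
  have h2 := measurePreserving_rotate (volume : Measure (Icc (0 : ℝ) 1))
    (κ := fun t => Circle.exp (s * G t)) (Continuous.measurable (by fun_prop))
  exact ((MeasurePreserving.id circleMeasure).prod h2).comp h1

/-- The time-`s` map of the flow on the thickened torus. -/
def torusFlowHomeomorph (hF : Continuous F) (hG : Continuous G) (s : ℝ) :
    ThickTorus ≃ₜ ThickTorus where
  toFun := torusFlow F G s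
  invFun := torusFlow F G (-s)
  left_inv := torusFlow_neg_torusFlow s
  right_inv := torusFlow_torusFlow_neg s
  continuous_toFun := (continuous_torusFlow hF hG).comp (Continuous.prodMk_right s)
  continuous_invFun := (continuous_torusFlow hF hG).comp (Continuous.prodMk_right (-s))

theorem measurableEmbedding_torusFlow (hF : Continuous F) (hG : Continuous G) (s : ℝ) :
    MeasurableEmbedding (torusFlow F G s) :=
  (torusFlowHomeomorph hF hG s).measurableEmbedding

theorem torusMeasure_image_torusFlow (hF : Continuous F) (hG : Continuous G) (s : ℝ)
    (A : Set ThickTorus) : torusMeasure (torusFlow F G s '' A) = torusMeasure A := by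
  have h := (measurePreserving_torusFlow hF hG s).measure_preimage_emb
    (measurableEmbedding_torusFlow hF hG s) (torusFlow F G s '' A)
  rw [← h, preimage_image_eq _ (measurableEmbedding_torusFlow hF hG s).injective]

/-- Provides the measurability of the swept sets. -/
theorem isCompact_sweep_torusFlow (hF : Continuous F) (hG : Continuous G) (ε : ℝ)
    {S : Set ThickTorus} (hS : IsClosed S) : IsCompact (sweep (torusFlow F G) ε S) := by
  have h : sweep (torusFlow F G) ε S =
      (fun q : ℝ × ThickTorus => torusFlow F G q.1 q.2) '' (Icc 0 ε ×ˢ S) := by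
    ext p
    rw [mem_sweep]
    exact ⟨fun ⟨s, hs, x, hx, h⟩ => ⟨(s, x), ⟨hs, hx⟩, h⟩, fun ⟨q, hq, h⟩ =>
      ⟨q.1, hq.1, q.2, hq.2, h⟩⟩
  rw [h]
  exact (isCompact_Icc.prod hS.isCompact).image (continuous_torusFlow hF hG)

theorem integral_torusMeasure_height (u : Icc (0 : ℝ) 1 → ℝ) :
    ∫ p, u p.2.2 ∂torusMeasure = (2 * Real.pi) ^ 2 * ∫ t, u t := by
  have hπ : circleMeasure.real univ = 2 * Real.pi := by
    rw [Measure.real, circleMeasure_univ, ENNReal.toReal_ofReal Real.two_pi_pos.le]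
  rw [torusMeasure, integral_fun_snd (fun q : Circle × Icc (0 : ℝ) 1 => u q.2),
    integral_fun_snd u, hπ]
  simp only [smul_eq_mul]
  ring

end TorusFlow

/-! ### The flux through the fibres of a map homotopic to the projection -/

section Crossing

variable {F G : Icc (0 : ℝ) 1 → ℝ}

/-- For small times, the variation of the lift of `p ↦ exp (h p) * p.1` along the flow lines is
uniformly less than a full turn. -/
theorem eventually_abs_lift_lt (hF : Continuous F) (hG : Continuous G) {h : ThickTorus → ℝ}
    (hh : Continuous h) :
    ∀ᶠ s in 𝓝 (0 : ℝ), ∀ p, |s * F p.2.2 + h (torusFlow F G s p) - h p| < 2 * Real.pi := by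
  have hc : Continuous fun q : ℝ × ThickTorus =>
      |q.1 * F q.2.2.2 + h (torusFlow F G q.1 q.2) - h q.2| := by
    have := continuous_torusFlow hF hG
    fun_prop
  have := (isCompact_univ (X := ThickTorus)).eventually_forall_of_forall_eventually (x₀ := (0 : ℝ))
    (P := fun s p => |s * F p.2.2 + h (torusFlow F G s p) - h p| < 2 * Real.pi) (fun p _ => by
      refine (hc.tendsto (0, p)).eventually_lt_const ?_
      simpa using Real.two_pi_pos)
  simpa using this

/-- A real function on `[0,ε]` whose integer part changes takes an integer value. -/
theorem exists_eq_intCast_of_floor_ne {v : ℝ → ℝ} {ε : ℝ} (hε : 0 ≤ ε) (hv : Continuous v)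
    (hne : ⌊v ε⌋ ≠ ⌊v 0⌋) : ∃ s ∈ Icc 0 ε, ∃ n : ℤ, v s = n := by
  have hivt := intermediate_value_uIcc (a := (0 : ℝ)) (b := ε) hv.continuousOn
  rw [uIcc_of_le hε] at hivt
  rcases lt_or_gt_of_ne hne with hlt | hlt
  · obtain ⟨s, hs, h⟩ := hivt (show (⌊v 0⌋ : ℝ) ∈ uIcc (v 0) (v ε) from
      mem_uIcc.2 (Or.inr ⟨(Int.floor_lt.1 hlt).le, Int.floor_le _⟩))
    exact ⟨s, hs, _, h⟩
  · obtain ⟨s, hs, h⟩ := hivt (show (⌊v ε⌋ : ℝ) ∈ uIcc (v 0) (v ε) from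
      mem_uIcc.2 (Or.inl ⟨(Int.floor_lt.1 hlt).le, Int.floor_le _⟩))
    exact ⟨s, hs, _, h⟩

theorem abs_floor_sub_floor_le_one {x y : ℝ} (h : |x - y| < 1) :
    |((⌊x⌋ : ℝ) - ⌊y⌋)| ≤ 1 := by
  have h1 := abs_lt.1 h
  have hx := Int.floor_le x
  have hx' := Int.lt_floor_add_one x
  have hy := Int.floor_le y
  have hy' := Int.lt_floor_add_one y
  have h2 : ⌊x⌋ - ⌊y⌋ < 2 := by
    have : ((⌊x⌋ - ⌊y⌋ : ℤ) : ℝ) < (2 : ℤ) := by push_cast; linarith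
    exact_mod_cast this
  have h3 : -2 < ⌊x⌋ - ⌊y⌋ := by
    have : ((-2 : ℤ) : ℝ) < (⌊x⌋ - ⌊y⌋ : ℤ) := by push_cast; linarith
    exact_mod_cast this
  have h4 : |⌊x⌋ - ⌊y⌋| ≤ 1 := abs_le.2 ⟨by omega, by omega⟩
  exact_mod_cast h4

/-- The set swept out in time `ε` by a fibre of a circle-valued map homotopic to the first
coordinate has volume at least `2π ε ∫ |F|`. -/
theorem eventually_le_torusMeasure_sweep (hF : Continuous F) (hG : Continuous G)
    {h : ThickTorus → ℝ} (hh : Continuous h) (θ : Circle) :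
    ∀ᶠ ε in 𝓝[>] (0 : ℝ), 2 * Real.pi * ε * ∫ t, |F t| ≤
      torusMeasure.real (sweep (torusFlow F G) ε {p | Circle.exp (h p) * p.1 = θ}) := by
  obtain ⟨δ, hδ, hball⟩ := Metric.eventually_nhds_iff.1 (eventually_abs_lift_lt hF hG hh)
  filter_upwards [Ioo_mem_nhdsGT hδ] with ε hε
  have hε0 : 0 < ε := hε.1
  set S : Set ThickTorus := {p | Circle.exp (h p) * p.1 = θ} with hS
  have hSc : IsClosed S := isClosed_eq (by fun_prop) continuous_const
  set A := sweep (torusFlow F G) ε S with hA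
  have hAm : MeasurableSet A := (isCompact_sweep_torusFlow hF hG ε hSc).measurableSet
  obtain ⟨c, hc⟩ : ∃ c, Circle.exp c = θ := ⟨_, Circle.exp_arg θ⟩
  -- the lift of the map, divided by `2π`, along the flow line of `p`
  set v : ThickTorus → ℝ → ℝ := fun p s =>
    ((p.1 : ℂ).arg + s * F p.2.2 + h (torusFlow F G s p) - c) / (2 * Real.pi) with hv
  have hvc : ∀ p, Continuous (v p) := by
    intro p
    have : Continuous fun s => torusFlow F G s p :=
      (continuous_torusFlow hF hG).comp (Continuous.prodMk_left p)
    fun_prop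
  set w : ThickTorus → ℝ := fun p => Int.fract (v p 0) with hw
  -- The lift carried along the flow and the lift restarted at the endpoint through `arg` differ by
  -- an integer, so the fractional part is a function of the endpoint. This makes `D` cohomologous
  -- to `ε F / 2π`.
  have hfract : ∀ p, Int.fract (v p ε) = w (torusFlow F G ε p) := by
    intro p
    have h1 : Circle.exp ((p.1 : ℂ).arg + ε * F p.2.2) =
        Circle.exp (((torusFlow F G ε p).1 : ℂ).arg) := by
      rw [Circle.exp_add, Circle.exp_arg, Circle.exp_arg]; rfl
    obtain ⟨m, hm⟩ := Circle.exp_eq_exp.1 h1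
    have h2 : v p ε = v (torusFlow F G ε p) 0 + m := by
      simp only [hv, hm, torusFlow_zero]
      field_simp
      ring
    rw [h2, Int.fract_add_intCast]
  set D : ThickTorus → ℝ := fun p => (⌊v p ε⌋ : ℝ) - ⌊v p 0⌋ with hD
  set K : ThickTorus → ℝ := fun p => h p / (2 * Real.pi) - w p with hK
  have hDK : ∀ p, D p = ε * F p.2.2 / (2 * Real.pi) + (K (torusFlow F G ε p) - K p) := by
    intro p
    have h1 : D p = v p ε - v p 0 - (w (torusFlow F G ε p) - w p) := by
      rw [← hfract]
      simp only [hD, hw, Int.fract]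
      ring
    rw [h1]
    simp only [hK, hv, torusFlow_zero]
    field_simp
    ring
  -- If the integer part changes, the lift is an integer at some time `s`, where the flow line meets
  -- `S`; flowing on for `ε - s` puts the endpoint in `A`.
  have hDA : ∀ p, |D p| ≤ A.indicator (fun _ => (1 : ℝ)) (torusFlow F G ε p) := by
    intro p
    by_cases hne : ⌊v p ε⌋ = ⌊v p 0⌋
    · simp only [hD, hne, sub_self, abs_zero]
      exact indicator_nonneg (fun _ _ => zero_le_one) _
    · obtain ⟨s, hs, n, hn⟩ := exists_eq_intCast_of_floor_ne hε0.le (hvc p) hne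
      have hmem : torusFlow F G ε p ∈ A := by
        refine mem_sweep.2 ⟨ε - s, ⟨by linarith [hs.2], by linarith [hs.1]⟩,
          torusFlow F G s p, ?_, by rw [← torusFlow_add, sub_add_cancel]⟩
        have h1 : h (torusFlow F G s p) + ((p.1 : ℂ).arg + s * F p.2.2) =
            c + n * (2 * Real.pi) := by
          simp only [hv] at hn
          field_simp at hn
          linarith
        have h2 := Circle.exp_eq_exp.2 ⟨n, h1⟩
        rw [Circle.exp_add, Circle.exp_add, Circle.exp_arg, hc] at h2
        exact h2
      rw [indicator_of_mem hmem]
      refine abs_floor_sub_floor_le_one ?_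
      have h3 := hball (y := ε) (by simpa [abs_of_pos hε0] using hε.2) p
      have h4 : v p ε - v p 0 =
          (ε * F p.2.2 + h (torusFlow F G ε p) - h p) / (2 * Real.pi) := by
        simp only [hv, torusFlow_zero]
        field_simp
        ring
      rw [h4, abs_div, abs_of_pos Real.two_pi_pos, div_lt_one Real.two_pi_pos]
      exact h3
  -- The sign depends only on `t`, hence is flow-invariant: it turns `F` into `|F|` and preserves
  -- the cancellation of the coboundary.
  set σ : ThickTorus → ℝ := fun p => (SignType.sign (F p.2.2) : ℝ) with hσ
  have hσm : Measurable σ := by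
    have h1 : Measurable fun p : ThickTorus => F p.2.2 := Continuous.measurable (by fun_prop)
    have h2 : σ = fun p => if 0 < F p.2.2 then (1 : ℝ) else if F p.2.2 < 0 then -1 else 0 := by
      ext p
      simp only [hσ, sign_apply]
      split_ifs <;> simp
    rw [h2]
    exact Measurable.ite (measurableSet_lt measurable_const h1) measurable_const
      (Measurable.ite (measurableSet_lt h1 measurable_const) measurable_const measurable_const)
  have hσ1 : ∀ p, |σ p| ≤ 1 := by
    intro p
    simp only [hσ]
    rcases lt_trichotomy (F p.2.2) 0 with h | h | h <;> simp [h]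
  have hKm : Measurable K := by
    have h1 : Measurable fun p : ThickTorus => (p.1 : ℂ).arg :=
      Complex.measurable_arg.comp (Continuous.measurable (by fun_prop))
    have h2 : Measurable h := hh.measurable
    simp only [hK, hw, hv, torusFlow_zero]
    fun_prop
  obtain ⟨B, hB⟩ : ∃ B, ∀ p, |h p| ≤ B := by
    obtain ⟨B, hB⟩ := (isCompact_univ (X := ThickTorus)).exists_bound_of_continuousOn
      hh.continuousOn
    exact ⟨B, fun p => by simpa using hB p (mem_univ p)⟩
  have hσK : Integrable (fun p => σ p * K p) torusMeasure := by
    refine Integrable.of_bound (hσm.mul hKm).aestronglyMeasurable (B / (2 * Real.pi) + 1)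
      (ae_of_all _ fun p => ?_)
    have h1 : |w p| ≤ 1 := by
      rw [abs_of_nonneg (Int.fract_nonneg _)]; exact (Int.fract_lt_one _).le
    have h2 : |h p / (2 * Real.pi)| ≤ B / (2 * Real.pi) := by
      rw [abs_div, abs_of_pos Real.two_pi_pos]
      exact div_le_div_of_nonneg_right (hB p) Real.two_pi_pos.le
    calc ‖σ p * K p‖ = |σ p| * |K p| := abs_mul _ _
      _ ≤ 1 * (|h p / (2 * Real.pi)| + |w p|) :=
        mul_le_mul (hσ1 p) (abs_sub _ _) (abs_nonneg _) zero_le_one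
      _ ≤ _ := by linarith
  have hmp := measurePreserving_torusFlow hF hG ε
  have hme := measurableEmbedding_torusFlow hF hG ε
  have hσK' : Integrable (fun p => σ p * K (torusFlow F G ε p)) torusMeasure :=
    (hmp.integrable_comp_emb hme).2 hσK
  have hFint : Integrable (fun p : ThickTorus => ε / (2 * Real.pi) * |F p.2.2|) torusMeasure := by
    have : Continuous fun p : ThickTorus => ε / (2 * Real.pi) * |F p.2.2| := by fun_prop
    exact this.integrable_of_hasCompactSupport (HasCompactSupport.of_compactSpace _)
  have hσD : ∀ p, σ p * D p = ε / (2 * Real.pi) * |F p.2.2| +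
      (σ p * K (torusFlow F G ε p) - σ p * K p) := by
    intro p
    rw [hDK, ← sign_mul_self (F p.2.2)]
    simp only [hσ]
    ring
  have hint : ∫ p, σ p * D p ∂torusMeasure = 2 * Real.pi * ε * ∫ t, |F t| := by
    have hinv : ∫ p, σ p * K (torusFlow F G ε p) ∂torusMeasure = ∫ p, σ p * K p ∂torusMeasure :=
      hmp.integral_comp hme fun p => σ p * K p
    simp_rw [hσD]
    rw [integral_add hFint (by exact hσK'.sub hσK), integral_sub hσK' hσK, hinv, sub_self, add_zero,
      integral_torusMeasure_height fun t => ε / (2 * Real.pi) * |F t|, integral_const_mul]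
    field_simp
  have hindic : ∫ p, A.indicator (fun _ => (1 : ℝ)) (torusFlow F G ε p) ∂torusMeasure =
      torusMeasure.real A := by
    rw [hmp.integral_comp hme, integral_indicator_const _ hAm, smul_eq_mul, mul_one]
  rw [← hint, ← hindic]
  refine integral_mono ?_ ?_ fun p => ?_
  · simp_rw [hσD]
    exact hFint.add (hσK'.sub hσK)
  · exact (hmp.integrable_comp_emb hme).2 ((integrable_const (1 : ℝ)).indicator hAm)
  · calc σ p * D p ≤ |σ p| * |D p| := by rw [← abs_mul]; exact le_abs_self _
      _ ≤ 1 * |D p| := mul_le_mul_of_nonneg_right (hσ1 p) (abs_nonneg _)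
      _ = |D p| := one_mul _
      _ ≤ _ := hDA p

/-- The set swept out in time `ε` by a fibre of the first coordinate has volume at most
`2π ε ∫ |F|`. -/
theorem torusMeasure_sweep_fst_le (hF : Continuous F) (hG : Continuous G) {ε : ℝ} (hε : 0 ≤ ε)
    (θ : Circle) : torusMeasure (sweep (torusFlow F G) ε {p | p.1 = θ}) ≤
      ENNReal.ofReal (2 * Real.pi * ε * ∫ t, |F t|) := by
  set A := sweep (torusFlow F G) ε {p | p.1 = θ} with hA
  have hAm : MeasurableSet A := (isCompact_sweep_torusFlow hF hG ε
    (isClosed_eq continuous_fst continuous_const)).measurableSet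
  obtain ⟨c, hc⟩ : ∃ c, Circle.exp c = θ := ⟨_, Circle.exp_arg θ⟩
  have hint : Integrable (fun t => |F t|) (volume : Measure (Icc (0 : ℝ) 1)) :=
    hF.abs.integrable_of_hasCompactSupport (HasCompactSupport.of_compactSpace _)
  have hslice : ∀ q : Circle × Icc (0 : ℝ) 1,
      circleMeasure ((fun a => (a, q)) ⁻¹' A) ≤ ENNReal.ofReal (ε * |F q.2|) := by
    intro q
    -- The starting value of `x₂` is not controlled, but neither the fibre nor `F` depends on it.
    have hsub : (fun a => (a, q)) ⁻¹' A ⊆ Circle.exp '' uIcc c (c + ε * F q.2) := by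
      intro a ha
      obtain ⟨s, hs, p, hp, hpa⟩ := mem_sweep.1 ha
      have h1 : p.1 * Circle.exp (s * F p.2.2) = a := congrArg Prod.fst hpa
      have h2 : p.2.2 = q.2 := congrArg (fun p : ThickTorus => p.2.2) hpa
      refine ⟨c + s * F q.2, ?_, by rw [Circle.exp_add, hc, ← h1, ← h2, ← show p.1 = θ from hp]⟩
      rcases le_total 0 (F q.2) with h | h
      · exact mem_uIcc.2 (Or.inl ⟨by nlinarith [hs.1], by nlinarith [hs.2]⟩)
      · exact mem_uIcc.2 (Or.inr ⟨by nlinarith [hs.2], by nlinarith [hs.1]⟩)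
    refine (measure_mono hsub).trans (circleMeasure_arc_le.trans (le_of_eq ?_))
    rw [add_sub_cancel_left, abs_mul, abs_of_nonneg hε]
  rw [torusMeasure, Measure.prod_apply_symm hAm]
  calc ∫⁻ q, circleMeasure ((fun a => (a, q)) ⁻¹' A) ∂(circleMeasure.prod volume)
      ≤ ∫⁻ q : Circle × Icc (0 : ℝ) 1, ENNReal.ofReal (ε * |F q.2|)
          ∂(circleMeasure.prod volume) := lintegral_mono hslice
    _ = ENNReal.ofReal (2 * Real.pi) * ∫⁻ t, ENNReal.ofReal (ε * |F t|) := by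
      have hc : Continuous fun q : Circle × Icc (0 : ℝ) 1 => ε * |F q.2| := by fun_prop
      rw [lintegral_prod _ hc.measurable.ennreal_ofReal.aemeasurable]
      simp only [lintegral_const, circleMeasure_univ]
      rw [mul_comm]
    _ = _ := by
      rw [← ofReal_integral_eq_lintegral_ofReal (hint.const_mul ε)
        (ae_of_all _ fun t => by positivity), integral_const_mul,
        ← ENNReal.ofReal_mul Real.two_pi_pos.le, mul_assoc (2 * Real.pi)]

theorem flux_fst_le (hF : Continuous F) (hG : Continuous G) (θ : Circle) :
    flux (torusFlow F G) torusMeasure {p | p.1 = θ} ≤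
      ENNReal.ofReal (2 * Real.pi * ∫ t, |F t|) := by
  have hlim := tendsto_fluxQuotient (φ := torusFlow F G) torusFlow_add
    (torusMeasure_image_torusFlow hF hG) {p | p.1 = θ}
  refine le_of_tendsto hlim ?_
  filter_upwards [self_mem_nhdsWithin] with ε (hε : 0 < ε)
  refine ENNReal.div_le_of_le_mul ((torusMeasure_sweep_fst_le hF hG hε.le θ).trans_eq ?_)
  rw [← ENNReal.ofReal_mul (by positivity)]
  congr 1; ring

theorem le_flux_of_lift (hF : Continuous F) (hG : Continuous G) {h : ThickTorus → ℝ}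
    (hh : Continuous h) (θ : Circle) : ENNReal.ofReal (2 * Real.pi * ∫ t, |F t|) ≤
      flux (torusFlow F G) torusMeasure {p | Circle.exp (h p) * p.1 = θ} := by
  have hlim := tendsto_fluxQuotient (φ := torusFlow F G) torusFlow_add
    (torusMeasure_image_torusFlow hF hG) {p | Circle.exp (h p) * p.1 = θ}
  refine ge_of_tendsto hlim ?_
  filter_upwards [eventually_le_torusMeasure_sweep hF hG hh θ, self_mem_nhdsWithin]
    with ε h1 (hε : 0 < ε)
  rw [fluxQuotient, ENNReal.le_div_iff_mul_le (Or.inl (by simpa using hε))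
    (Or.inl ENNReal.ofReal_ne_top), ← ENNReal.ofReal_mul (by positivity)]
  refine (ENNReal.ofReal_le_ofReal (le_trans (le_of_eq (by ring)) h1)).trans_eq ?_
  rw [ofReal_measureReal]

end Crossing

/-! ### Homotopy lifting. -/

/-- A map homotopic to the first coordinate is `p ↦ exp (h p) * p.1` for a continuous `h`. -/
theorem exists_lift_of_homotopy {A : Type*} [TopologicalSpace A] {q : A → Circle}
    (hq : Continuous q) {P : ℝ → A → Circle}
    (hP : ContinuousOn (fun x : ℝ × A => P x.1 x.2) (Icc 0 1 ×ˢ univ)) (h0 : P 0 = q) :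
    ∃ h : A → ℝ, Continuous h ∧ ∀ p, P 1 p = Circle.exp (h p) * q p := by
  -- The quotient by `q` is a homotopy starting at the constant `1`, so it lifts through the
  -- covering `exp` from the initial lift `0`.
  have hc : Continuous fun x : unitInterval × A => P x.1 x.2 * (q x.2)⁻¹ := by
    have : Continuous fun x : unitInterval × A => P x.1 x.2 :=
      hP.comp_continuous (f := fun x : unitInterval × A => ((x.1 : ℝ), x.2)) (by fun_prop)
        fun x => ⟨x.1.2, mem_univ _⟩
    exact this.mul (hq.comp continuous_snd).inv
  let Q : C(unitInterval × A, Circle) := ⟨_, hc⟩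
  have hQ0 : ∀ a, Q (0, a) = Circle.exp ((ContinuousMap.const A (0 : ℝ)) a) := by
    intro a
    simp [Q, h0]
  let L := Circle.isCoveringMap_exp.liftHomotopy Q (ContinuousMap.const A 0) hQ0
  refine ⟨fun a => L (1, a), by fun_prop, fun a => ?_⟩
  have := congrFun (Circle.isCoveringMap_exp.liftHomotopy_lifts Q _ hQ0) (1, a)
  have h2 : Circle.exp (L (1, a)) = P 1 a * (q a)⁻¹ := this
  rw [h2, inv_mul_cancel_right]

/-! ### The thickened torus inside the manifold -/

theorem contMDiff_torusPoint (t : Icc (0 : ℝ) 1) :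
    ContMDiff 𝓘(ℝ, ℝ × ℝ) thickTorusModel ∞ fun z : ℝ × ℝ => torusPoint z.1 z.2 t := by
  have h1 : ContMDiff 𝓘(ℝ, ℝ × ℝ) (𝓡 1) ∞ fun z : ℝ × ℝ => Circle.exp z.1 :=
    contMDiff_circleExp.comp contDiff_fst.contMDiff
  have h2 : ContMDiff 𝓘(ℝ, ℝ × ℝ) (𝓡 1) ∞ fun z : ℝ × ℝ => Circle.exp z.2 :=
    contMDiff_circleExp.comp contDiff_snd.contMDiff
  exact h1.prodMk (h2.prodMk contMDiff_const)

theorem torusFlow_torusPoint (F G : Icc (0 : ℝ) 1 → ℝ) (s : ℝ) (x : ℝ × ℝ)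
    (t : Icc (0 : ℝ) 1) : torusFlow F G s (torusPoint x.1 x.2 t) =
      torusPoint (x.1 + s * F t) (x.2 + s * G t) t := by
  simp [torusFlow, torusPoint, Circle.exp_add]

theorem exists_torusPoint_eq (p : ThickTorus) : ∃ x : ℝ × ℝ, torusPoint x.1 x.2 p.2.2 = p :=
  ⟨((p.1 : ℂ).arg, (p.2.1 : ℂ).arg), by simp [torusPoint]⟩

theorem comp_one_smulRight {V W : Type*} [AddCommGroup V] [Module ℝ V] [TopologicalSpace V]
    [IsTopologicalAddGroup V] [ContinuousSMul ℝ V] [AddCommGroup W] [Module ℝ W]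
    [TopologicalSpace W] [IsTopologicalAddGroup W] [ContinuousSMul ℝ W] (A : V →L[ℝ] W) (v : V) :
    A.comp ((1 : ℝ →L[ℝ] ℝ).smulRight v) = (1 : ℝ →L[ℝ] ℝ).smulRight (A v) := by
  ext
  simp

/-- The image of `e` is invariant under the backward flow too, so no point enters it from outside.
-/
theorem preimage_sweep {Y : Type*} {φ : ℝ → Y → Y} {e : ThickTorus → Y}
    {F G : Icc (0 : ℝ) 1 → ℝ} (h0 : ∀ y, φ 0 y = y) (hadd : ∀ s r y, φ (s + r) y = φ s (φ r y))
    (hφe : ∀ s p, φ s (e p) = e (torusFlow F G s p)) (ε : ℝ) (S : Set Y) :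
    e ⁻¹' sweep φ ε S = sweep (torusFlow F G) ε (e ⁻¹' S) := by
  ext p
  rw [mem_preimage, mem_sweep, mem_sweep]
  refine ⟨fun ⟨s, hs, y, hy, h⟩ => ⟨s, hs, torusFlow F G (-s) p, ?_, torusFlow_torusFlow_neg s p⟩,
    fun ⟨s, hs, q, hq, h⟩ => ⟨s, hs, e q, hq, by rw [hφe, h]⟩⟩
  rw [mem_preimage, ← hφe, ← h, ← hadd, neg_add_cancel, h0]
  exact hy

section Embedded

variable {E : Type*} [NormedAddCommGroup E] [NormedSpace ℝ E]
  {H : Type*} [TopologicalSpace H] {I : ModelWithCorners ℝ E H}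
  {Y : Type*} [TopologicalSpace Y] [ChartedSpace H Y]

theorem IsFlowOf.add {X : (y : Y) → TangentSpace I y} {φ : ℝ → Y → Y} (hφ : IsFlowOf I X φ)
    (s r : ℝ) (y : Y) : φ (s + r) y = φ s (φ r y) := by
  have h := hφ.unique _ ((hφ.integral y).comp_add r) s
  simpa using h

/-- The flow of a vector field of the form `F ∂₁ + G ∂₂` on an embedded thickened torus. -/
theorem IsFlowOf.apply_thickTorus {X : (y : Y) → TangentSpace I y} {φ : ℝ → Y → Y}
    (hφ : IsFlowOf I X φ) {e : ThickTorus → Y} (he : ContMDiff thickTorusModel I ∞ e)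
    {F G : Icc (0 : ℝ) 1 → ℝ}
    (hX : ∀ (x : ℝ × ℝ) (t : Icc (0 : ℝ) 1),
      X (e (torusPoint x.1 x.2 t)) =
        mfderiv 𝓘(ℝ, ℝ × ℝ) I (fun z : ℝ × ℝ => e (torusPoint z.1 z.2 t)) x (F t, G t))
    (s : ℝ) (p : ThickTorus) : φ s (e p) = e (torusFlow F G s p) := by
  obtain ⟨x, hx⟩ := exists_torusPoint_eq p
  obtain ⟨t, ht⟩ : ∃ t, p.2.2 = t := ⟨_, rfl⟩
  rw [ht] at hx
  subst hx
  -- A straight line in the universal cover of the torus at height `t`; its image is an integral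
  -- curve, and uniqueness identifies it with the flow line.
  set γ : ℝ → ℝ × ℝ := fun s => (x.1 + s * F t, x.2 + s * G t) with hγ
  have hint : IsMIntegralCurve (I := I) (fun s => e (torusPoint (γ s).1 (γ s).2 t)) X := by
    intro s
    have hγd : HasMFDerivAt 𝓘(ℝ, ℝ) 𝓘(ℝ, ℝ × ℝ) γ s
        ((1 : ℝ →L[ℝ] ℝ).smulRight ((F t, G t) : ℝ × ℝ)) := by
      refine HasFDerivAt.hasMFDerivAt ?_
      have h1 : HasDerivAt γ ((F t, G t) : ℝ × ℝ) s := by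
        refine HasDerivAt.prodMk ?_ ?_
        · simpa using ((hasDerivAt_id s).mul_const (F t)).const_add x.1
        · simpa using ((hasDerivAt_id s).mul_const (G t)).const_add x.2
      exact h1.hasFDerivAt
    have hd : MDifferentiableAt 𝓘(ℝ, ℝ × ℝ) I
        (fun z : ℝ × ℝ => e (torusPoint z.1 z.2 t)) (γ s) :=
      ((he.comp (contMDiff_torusPoint t)) (γ s)).mdifferentiableAt (by simp)
    have hc := hd.hasMFDerivAt.comp s hγd
    rw [hX (γ s) t]
    exact hc.congr_mfderiv (comp_one_smulRight _ _)
  have h := hφ.unique _ hint s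
  rw [torusFlow_torusPoint, h]
  simp [hγ]

/-- Compact into Hausdorff makes `e` a closed, hence measurable, embedding, so the pushforward is
computed by preimages even on nonmeasurable sets. -/
theorem fluxQuotient_thickTorusVolume [T2Space Y] [MeasurableSpace Y] [BorelSpace Y]
    {φ : ℝ → Y → Y} {e : ThickTorus → Y} (hec : Continuous e) (he : Function.Injective e)
    {F G : Icc (0 : ℝ) 1 → ℝ} (h0 : ∀ y, φ 0 y = y) (hadd : ∀ s r y, φ (s + r) y = φ s (φ r y))
    (hφe : ∀ s p, φ s (e p) = e (torusFlow F G s p)) (S : Set Y) :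
    fluxQuotient φ (thickTorusVolume e) S =
      fluxQuotient (torusFlow F G) torusMeasure (e ⁻¹' S) := by
  ext ε
  rw [fluxQuotient, fluxQuotient, thickTorusVolume_eq_map hec,
    (hec.isClosedEmbedding he).measurableEmbedding.map_apply, preimage_sweep h0 hadd hφe]

theorem self_mem_fibrationsIsotopicTo {π : Y → Circle} (hπ : IsSmoothFibration I π) :
    π ∈ fibrationsIsotopicTo I π :=
  ⟨fun _ => π, (hπ.1.comp contMDiff_snd).contMDiffOn, fun _ _ => hπ, rfl, rfl⟩

end Embedded

end

/-! ### Existence of the flux and value of the wrappingness. -/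

theorem mainTheorem8
    {E : Type*} [NormedAddCommGroup E] [NormedSpace ℝ E]
    {H : Type*} [TopologicalSpace H] (I : ModelWithCorners ℝ E H)
    {Y : Type*} [TopologicalSpace Y] [T2Space Y] [ChartedSpace H Y] [IsManifold I ∞ Y]
    [MeasurableSpace Y] [BorelSpace Y]
    (hdim : Module.finrank ℝ E = 3)
    (π : Y → Circle) (hπ : IsSmoothFibration I π)
    (e : ThickTorus → Y) (he : Manifold.IsSmoothEmbedding thickTorusModel I ∞ e)
    (hπe : ∀ p : ThickTorus, π (e p) = p.1)
    (f g : ℝ → ℝ) (hf : ContinuousOn f (Icc 0 1)) (hg : ContinuousOn g (Icc 0 1))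
    (X : (y : Y) → TangentSpace I y) (φ : ℝ → Y → Y) (hφ : IsFlowOf I X φ)
    (hX : ∀ (x : ℝ × ℝ) (t : Icc (0 : ℝ) 1),
      X (e (torusPoint x.1 x.2 t)) =
        mfderiv 𝓘(ℝ, ℝ × ℝ) I (fun z : ℝ × ℝ => e (torusPoint z.1 z.2 t)) x (f t, g t)) :
    (∀ π' ∈ fibrationsIsotopicTo I π, ∀ θ : Circle,
      Tendsto (fluxQuotient φ (thickTorusVolume e) (π' ⁻¹' {θ})) (𝓝[>] (0 : ℝ))
        (𝓝 (flux φ (thickTorusVolume e) (π' ⁻¹' {θ})))) ∧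
    wrappingness I φ (thickTorusVolume e) π =
      ENNReal.ofReal (2 * Real.pi * ∫ t in (0 : ℝ)..1, |f t|) := by
  set F : Icc (0 : ℝ) 1 → ℝ := fun t => f t with hF
  set G : Icc (0 : ℝ) 1 → ℝ := fun t => g t with hG
  have hFc : Continuous F := continuousOn_iff_continuous_domRestrict.1 hf
  have hGc : Continuous G := continuousOn_iff_continuous_domRestrict.1 hg
  have hec : Continuous e := he.contMDiff.continuous
  have hφe := hφ.apply_thickTorus (F := F) (G := G) he.contMDiff hX
  have hquot := fluxQuotient_thickTorusVolume hec he.isEmbedding.injective hφ.zero hφ.add hφe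
  have hflux : ∀ S, flux φ (thickTorusVolume e) S =
      flux (torusFlow F G) torusMeasure (e ⁻¹' S) := fun S => by rw [flux, flux, hquot]
  have hint : ∫ t in (0 : ℝ)..1, |f t| = ∫ t, |F t| := by
    rw [intervalIntegral.integral_of_le zero_le_one, ← integral_Icc_eq_integral_Ioc,
      ← integral_subtype measurableSet_Icc fun t => |f t|]
  refine ⟨fun π' _ θ => ?_, le_antisymm ?_ ?_⟩
  · rw [hquot, hflux]
    exact tendsto_fluxQuotient torusFlow_add (torusMeasure_image_torusFlow hFc hGc) _
  -- The fibration `π` itself already realises the bound; the angle `1` is an arbitrary choice.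
  · refine (iInf₂_le π (self_mem_fibrationsIsotopicTo hπ)).trans ((iInf_le _ 1).trans ?_)
    have hS : e ⁻¹' (π ⁻¹' {1}) = {p | p.1 = 1} := by
      ext p
      simp [hπe]
    rw [hflux, hS, hint]
    exact flux_fst_le hFc hGc 1
  · refine le_iInf₂ fun π' hπ' => le_iInf fun θ => ?_
    obtain ⟨P, hP, -, hP0, hP1⟩ := hπ'
    have hPe : ContinuousOn (fun x : ℝ × ThickTorus => P x.1 (e x.2)) (Icc 0 1 ×ˢ univ) :=
      hP.continuousOn.comp (f := fun x : ℝ × ThickTorus => (x.1, e x.2)) (by fun_prop)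
        fun x hx => ⟨hx.1, mem_univ _⟩
    obtain ⟨h, hh, hPh⟩ := exists_lift_of_homotopy (P := fun s p => P s (e p)) continuous_fst hPe
      (by ext1 p; rw [hP0, hπe])
    have hS : e ⁻¹' (π' ⁻¹' {θ}) = {p | Circle.exp (h p) * p.1 = θ} := by
      ext p
      rw [mem_preimage, mem_preimage, mem_singleton_iff, mem_ofPred_eq, ← hPh, hP1]
    rw [hflux, hS, hint]
    exact le_flux_of_lift hFc hGc hh θ
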